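/- Let $X$ be a complex Banach space with open unit ball $B_X$, and let $\mathcal A$ be either $\mathcal A_u(B_X)$ (the uniformly continuous holomorphic functions $B_X\to\mathbb C$) or $\mathcal H^\infty(B_X)$ (the bounded holomorphic functions $B_X\to\mathbb C$), with the supremum norm. Let $\mathcal M(\mathcal A)$ be the set of nonzero homomorphisms $\mathcal A\to\mathbb C$. For $\varphi,\psi\in\mathcal M(\mathcal A)$ put $\rho(\varphi,\psi)=\sup\{|\varphi(f)| : f\in\mathcal A,\ \|f\|\le 1,\ \psi(f)=0\}$, and let $\mathcal{GP}(\varphi)=\{\psi\in\mathcal M(\mathcal A) : \rho(\varphi,\psi)<1\}$ be the Gleason part of $\varphi$. For $z$ in the open unit ball $B_{X^{**}}$ of the bidual let $\delta_z(f)=\tilde f(z)$, where $\tilde f$ is the canonical (Aron–Berner, Davie–Gamelin) extension of $f$ to $B_{X^{**}}$: $\tilde f=\sum_n\tilde P_n$, where $f=\sum_n P_n$ is the Taylor series of $f$ at $0$ and $\tilde P_n(z)=\tilde A_n(z,\dots,z)$, with $\tilde A_n$ the extension to $X^{**}$, one variable at a time by weak-star limits, of the symmetric $n$-linear form $A_n$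 of $P_n$. Let $\mathcal M_0=\{\varphi\in\mathcal M(\mathcal A) : \varphi|_{X^*}=0\}$ be the fiber over $0$, where $X^*\subset\mathcal A$ by restriction to $B_X$. Suppose that there is a norm continuous polynomial $P\colon X\to\mathbb C$ whose restriction to $B_X$ is not weakly continuous. Then $B_{X^{**}}\subsetneqq\mathcal{GP}(\delta_0)$, where $z\in B_{X^{**}}$ is identified with $\delta_z$; that is, $z\mapsto\delta_z$ is injective on $B_{X^{**}}$, each $\delta_z$ with $z\in B_{X^{**}}$ is an element of $\mathcal{GP}(\delta_0)$, and $\{\delta_z : z\in B_{X^{**}}\}\neq\mathcal{GP}(\delta_0)$. Moreover, there is $\varphi\in\mathcal M_0\cap\mathcal{GP}(\delta_0)$ with $\varphi\neq\delta_0$. -/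

import Mathlib

noncomputable section

open Metric

namespace GleasonParts

/-- `P` is a continuous polynomial on `X`: a finite sum of restrictions to the diagonal of
continuous `k`-linear forms. -/
def IsContinuousPolynomial {X : Type*} [NormedAddCommGroup X] [NormedSpace ℂ X]
    (P : X → ℂ) : Prop :=
  ∃ (N : ℕ) (A : (k : ℕ) → ContinuousMultilinearMap ℂ (fun _ : Fin k => X) ℂ),
    ∀ x : X, P x = ∑ k ∈ Finset.range (N + 1), A k (fun _ => x)

/-- `P` restricted to the open unit ball is continuous for the weak topology of `X`. -/
def IsWeaklyContinuousOnBall {X : Type*} [NormedAddCommGroup X] [NormedSpace ℂ X]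
    (P : X → ℂ) : Prop :=
  ContinuousOn (fun y : WeakSpace ℂ X => P ((toWeakSpace ℂ X).symm y))
    (toWeakSpace ℂ X '' ball (0 : X) 1)

/-- Bounded continuous functions on the open unit ball, with the supremum norm. -/
abbrev BallFun (X : Type*) [NormedAddCommGroup X] [NormedSpace ℂ X] : Type _ :=
  BoundedContinuousFunction (ball (0 : X) 1) ℂ

open Classical in
/-- Extension by zero of a function on the open unit ball. Only its values in the ball matter. -/
def zeroExt {X : Type*} [NormedAddCommGroup X] [NormedSpace ℂ X] (f : BallFun X) (x : X) : ℂ :=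
  if h : x ∈ ball (0 : X) 1 then f ⟨x, h⟩ else 0

theorem zeroExt_of_mem {X : Type*} [NormedAddCommGroup X] [NormedSpace ℂ X] (f : BallFun X)
    {x : X} (h : x ∈ ball (0 : X) 1) : zeroExt f x = f ⟨x, h⟩ := by
  simp only [zeroExt, dif_pos h]

/-- `H^∞(B_X)`: the algebra of bounded holomorphic functions on the open unit ball. -/
def Hinf (X : Type*) [NormedAddCommGroup X] [NormedSpace ℂ X] : Subalgebra ℂ (BallFun X) where
  carrier := {f | DifferentiableOn ℂ (zeroExt f) (ball (0 : X) 1)}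
  mul_mem' {f g} hf hg := by
    refine (DifferentiableOn.mul hf hg).congr fun x hx => ?_
    simp [zeroExt_of_mem _ hx]
  add_mem' {f g} hf hg := by
    refine (DifferentiableOn.add hf hg).congr fun x hx => ?_
    simp [zeroExt_of_mem _ hx]
  algebraMap_mem' c := by
    refine (differentiableOn_const c).congr fun x hx => ?_
    simp [zeroExt_of_mem _ hx]

/-- `A_u(B_X)`: the algebra of uniformly continuous holomorphic functions on the open unit ball
(these are automatically bounded). -/
def Au (X : Type*) [NormedAddCommGroup X] [NormedSpace ℂ X] : Subalgebra ℂ (BallFun X) where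
  carrier := {f | f ∈ Hinf X ∧ UniformContinuous f}
  mul_mem' {f g} hf hg := by
    refine ⟨mul_mem hf.1 hg.1, ?_⟩
    have hf2 := Metric.uniformContinuous_iff.1 hf.2
    have hg2 := Metric.uniformContinuous_iff.1 hg.2
    refine Metric.uniformContinuous_iff.2 fun ε hε => ?_
    have hK : 0 < ‖f‖ + ‖g‖ + 1 := by positivity
    obtain ⟨d₁, hd₁, h₁⟩ := hf2 (ε / (‖f‖ + ‖g‖ + 1)) (by positivity)
    obtain ⟨d₂, hd₂, h₂⟩ := hg2 (ε / (‖f‖ + ‖g‖ + 1)) (by positivity)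
    refine ⟨min d₁ d₂, lt_min hd₁ hd₂, fun a b hab => ?_⟩
    have e₁ := h₁ (lt_of_lt_of_le hab (min_le_left _ _))
    have e₂ := h₂ (lt_of_lt_of_le hab (min_le_right _ _))
    rw [dist_eq_norm] at e₁ e₂ ⊢
    have key : (f * g) a - (f * g) b = f a * (g a - g b) + (f a - f b) * g b := by
      simp only [BoundedContinuousFunction.mul_apply]; ring
    rw [key]
    calc ‖f a * (g a - g b) + (f a - f b) * g b‖
        ≤ ‖f a‖ * ‖g a - g b‖ + ‖f a - f b‖ * ‖g b‖ := by
          simpa only [norm_mul] using norm_add_le (f a * (g a - g b)) ((f a - f b) * g b)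
      _ ≤ ‖f‖ * (ε / (‖f‖ + ‖g‖ + 1)) + (ε / (‖f‖ + ‖g‖ + 1)) * ‖g‖ := by
          gcongr
          · exact f.norm_coe_le_norm a
          · exact g.norm_coe_le_norm b
      _ = ε * ((‖f‖ + ‖g‖) / (‖f‖ + ‖g‖ + 1)) := by ring
      _ < ε * 1 := by
          gcongr
          rw [div_lt_one hK]
          linarith
      _ = ε := mul_one ε
  add_mem' {f g} hf hg := ⟨add_mem hf.1 hg.1, hf.2.add hg.2⟩
  algebraMap_mem' c := ⟨algebraMap_mem _ c, uniformContinuous_const⟩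

theorem Au_le_Hinf (X : Type*) [NormedAddCommGroup X] [NormedSpace ℂ X] : Au X ≤ Hinf X :=
  fun _ hf => hf.1

/-! ### The spectrum, the pseudo-hyperbolic distance and Gleason parts -/

/-- `ρ(φ, ψ) = sup {|φ(f)| : ‖f‖ ≤ 1, ψ(f) = 0}`. -/
def pseudoHyperbolicDist {A : Type*} [NormedRing A] [NormedAlgebra ℂ A]
    (φ ψ : WeakDual.characterSpace ℂ A) : ℝ :=
  sSup {r : ℝ | ∃ f : A, ‖f‖ ≤ 1 ∧ ψ f = 0 ∧ r = ‖φ f‖}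

/-- The Gleason part of `φ`. -/
def gleasonPart {A : Type*} [NormedRing A] [NormedAlgebra ℂ A]
    (φ : WeakDual.characterSpace ℂ A) : Set (WeakDual.characterSpace ℂ A) :=
  {ψ | pseudoHyperbolicDist φ ψ < 1}

/-- Evaluation at the origin, as a point of the spectrum. -/
def deltaZero {X : Type*} [NormedAddCommGroup X] [NormedSpace ℂ X]
    (𝒜 : Subalgebra ℂ (BallFun X)) : WeakDual.characterSpace ℂ 𝒜 :=
  ⟨StrongDual.toWeakDual
      ((BoundedContinuousFunction.evalCLM ℂ (⟨0, mem_ball_self one_pos⟩ : ball (0 : X) 1)).comp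
        (Subalgebra.toSubmodule 𝒜).subtypeL),
    fun h => one_ne_zero (α := ℂ) (DFunLike.congr_fun h (1 : 𝒜)), fun _ _ => rfl⟩

/-! ### The inclusion `X* ⊂ A` and the projection onto the closed ball of the bidual -/

/-- The restriction of a continuous linear functional to the open unit ball. -/
def dualRestrict {X : Type*} [NormedAddCommGroup X] [NormedSpace ℂ X]
    (l : StrongDual ℂ X) : BallFun X :=
  BoundedContinuousFunction.ofNormedAddCommGroup (fun x : ball (0 : X) 1 => l x)
    (l.continuous.comp continuous_subtype_val) ‖l‖ fun x => by
      have hx : ‖(x : X)‖ ≤ 1 := (mem_ball_zero_iff.1 x.2).le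
      exact (l.le_opNorm x).trans (mul_le_of_le_one_right (norm_nonneg l) hx)

theorem dualRestrict_mem_Au {X : Type*} [NormedAddCommGroup X] [NormedSpace ℂ X]
    (l : StrongDual ℂ X) : dualRestrict l ∈ Au X := by
  refine ⟨l.differentiable.differentiableOn.congr fun x hx => ?_,
    l.uniformContinuous.comp uniformContinuous_subtype_val⟩
  rw [zeroExt_of_mem _ hx]
  rfl

/-- The inclusion of `X*` into an algebra `𝒜` containing `A_u(B_X)`
(`𝒜 = A_u(B_X)` or `𝒜 = H^∞(B_X)`). -/
def dualIncl {X : Type*} [NormedAddCommGroup X] [NormedSpace ℂ X]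
    (𝒜 : Subalgebra ℂ (BallFun X)) (h𝒜 : Au X ≤ 𝒜) : StrongDual ℂ X →L[ℂ] 𝒜 :=
  LinearMap.mkContinuous
    { toFun := fun l => ⟨dualRestrict l, h𝒜 (dualRestrict_mem_Au l)⟩
      map_add' := fun _ _ => rfl
      map_smul' := fun _ _ => rfl } 1 fun l => by
    rw [one_mul]
    change ‖dualRestrict l‖ ≤ ‖l‖
    refine (BoundedContinuousFunction.norm_le (norm_nonneg l)).2 fun x => ?_
    have hx : ‖(x : X)‖ ≤ 1 := (mem_ball_zero_iff.1 x.2).le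
    exact (l.le_opNorm x).trans (mul_le_of_le_one_right (norm_nonneg l) hx)

/-- `π(φ) = φ|_{X*}`, an element of the bidual. -/
def projBidual {X : Type*} [NormedAddCommGroup X] [NormedSpace ℂ X]
    (𝒜 : Subalgebra ℂ (BallFun X)) (h𝒜 : Au X ≤ 𝒜) (φ : WeakDual.characterSpace ℂ 𝒜) :
    StrongDual ℂ (StrongDual ℂ X) :=
  (WeakDual.toStrongDual (φ : WeakDual ℂ 𝒜)).comp (dualIncl 𝒜 h𝒜)

/-- The fiber `M_z` over `z`. -/
def fiber {X : Type*} [NormedAddCommGroup X] [NormedSpace ℂ X]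
    (𝒜 : Subalgebra ℂ (BallFun X)) (h𝒜 : Au X ≤ 𝒜) (z : StrongDual ℂ (StrongDual ℂ X)) :
    Set (WeakDual.characterSpace ℂ 𝒜) :=
  {φ | projBidual 𝒜 h𝒜 φ = z}

/-! ### The canonical (Aron–Berner, Davie–Gamelin) extension to the bidual -/

/-- `aronBerner n z A` is the value at `(z 0, …, z (n-1))` of the canonical extension of the
`n`-linear form `A` to the bidual, obtained by extending one variable at a time:
`Ã(z₀, …, zₙ₋₁) = z₀ (x ↦ (A(x, ·))~(z₁, …, zₙ₋₁))`, i.e. the iterated weak-star limit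
`lim_{x₀ → z₀} ⋯ lim_{xₙ₋₁ → zₙ₋₁} A(x₀, …, xₙ₋₁)` over points of `X`. -/
def aronBerner {X : Type*} [NormedAddCommGroup X] [NormedSpace ℂ X] :
    (n : ℕ) → (Fin n → StrongDual ℂ (StrongDual ℂ X)) →
      (ContinuousMultilinearMap ℂ (fun _ : Fin n => X) ℂ →L[ℂ] ℂ)
  | 0, _ => ContinuousMultilinearMap.apply ℂ (fun _ : Fin 0 => X) ℂ 0
  | n + 1, z =>
    (z 0).comp
      ((ContinuousLinearMap.compL ℂ X (ContinuousMultilinearMap ℂ (fun _ : Fin n => X) ℂ) ℂ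
          (aronBerner n (Fin.tail z))).comp
        (continuousMultilinearCurryLeftEquiv ℂ
          (fun _ : Fin (n + 1) => X) ℂ).toContinuousLinearEquiv.toContinuousLinearMap)

theorem aronBerner_succ_apply {X : Type*} [NormedAddCommGroup X] [NormedSpace ℂ X] (n : ℕ)
    (z : Fin (n + 1) → StrongDual ℂ (StrongDual ℂ X))
    (A : ContinuousMultilinearMap ℂ (fun _ : Fin (n + 1) => X) ℂ) :
    aronBerner (n + 1) z A = z 0 ((aronBerner n (Fin.tail z)).comp A.curryLeft) :=
  rfl

/-- The canonical extension `f̃(z)`, `‖z‖ < 1`, of a bounded holomorphic function `f` on the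
ball: with `f = ∑ Pₙ` the Taylor series at `0`, where `Pₙ(x) = Dⁿf(0)(x, …, x) / n!` and `Dⁿf(0)`
is symmetric, `f̃(z) = ∑ P̃ₙ(z)`. -/
def canonicalExt {X : Type*} [NormedAddCommGroup X] [NormedSpace ℂ X] (f : BallFun X)
    (z : StrongDual ℂ (StrongDual ℂ X)) : ℂ :=
  ∑' n : ℕ, ((n.factorial : ℂ))⁻¹ * aronBerner n (fun _ => z) (iteratedFDeriv ℂ n (zeroExt f) 0)

/-- The evaluation `δ_z : f ↦ f̃(z)` on the algebra `𝒜`, as a function `𝒜 → ℂ`. -/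
def delta {X : Type*} [NormedAddCommGroup X] [NormedSpace ℂ X]
    (𝒜 : Subalgebra ℂ (BallFun X)) (z : StrongDual ℂ (StrongDual ℂ X)) : 𝒜 → ℂ :=
  fun f => canonicalExt (f : BallFun X) z

end GleasonParts

end

/-! If a character is a limit of evaluations at points of norm at most `r < 1`, it lies in the
Gleason part of `δ_0`: when the limit kills `f` with `‖f‖ ≤ 1`, Schwarz-Pick between `0` and those
points gives `|f(0)| ≤ r` (`exists_mem_gleasonPart_of_tendsto`). Both kinds of character in the
theorem arise in this way.

For `δ_z` with `‖z‖ < 1`, Goldstine gives points of `X` tending weak-star to `z`, but a nonlinear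
polynomial need not follow that limit. Davie and Gamelin replace the points by arithmetic means of
long tuples, chosen one entry after another. By symmetry, each term with distinct indices in the
multilinear expansion tends to the Aron-Berner value, and the proportion of the other terms vanishes
(`exists_filter_tendsto_aronBerner`). Cauchy estimates on smaller balls carry this from polynomials
to Taylor series (`tendsto_zeroExt_canonicalExt`).

For the extra character, expand the given polynomial around a point `x₀` of weak discontinuity. Some
homogeneous part of positive degree fails to tend to `0` along a weakly null family; homogeneity
allows this family to be shrunk into the ball of radius `1/2`. An ultrafilter limit of evaluations
along it vanishes on `X*` but differs from `δ_0` on that part. It is no `δ_z`, since `δ_z` restricts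
to `z` on `X*`, which would force `z = 0`; the same restriction makes `z ↦ δ_z` injective. -/

noncomputable section

open Metric Set Filter Topology Asymptotics

namespace GleasonParts

/-! ### Holomorphic maps between normed spaces: the derivative is holomorphic. -/

section Holomorphic

variable {E : Type*} [NormedAddCommGroup E] [NormedSpace ℂ E]
  {F : Type*} [NormedAddCommGroup F] [NormedSpace ℂ F]

/-- Cauchy estimate for the Fréchet derivative. -/
theorem norm_fderiv_le_of_norm_le {f : E → F} {c : E} {R M : ℝ} (hR : 0 < R)
    (hd : DifferentiableOn ℂ f (ball c R)) (hM : ∀ x ∈ ball c R, ‖f x‖ ≤ M) :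
    ‖fderiv ℂ f c‖ ≤ 2 * M / R := by
  refine Complex.norm_fderiv_le_div_of_mapsTo_ball hd (fun x hx => ?_) hR
  rw [mem_closedBall, dist_eq_norm]
  linarith [norm_sub_le (f x) (f c), hM x hx, hM c (mem_ball_self hR)]

/-- Quadratic estimate for the remainder of the first order Taylor expansion. -/
theorem norm_sub_sub_fderiv_le {f : E → F} {c : E} {R M : ℝ} (hR : 0 < R)
    (hd : DifferentiableOn ℂ f (ball c R)) (hM : ∀ x ∈ ball c R, ‖f x‖ ≤ M)
    {h : E} (hh : ‖h‖ < R) :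
    ‖f (c + h) - f c - fderiv ℂ f c h‖ ≤ 4 * M * (‖h‖ / R) ^ 2 := by
  have hM0 : 0 ≤ M := (norm_nonneg _).trans (hM c (mem_ball_self hR))
  have hf' := norm_fderiv_le_of_norm_le hR hd hM
  have hdc : DifferentiableAt ℂ f c := hd.differentiableAt (ball_mem_nhds c hR)
  -- Schwarz's lemma for a map agreeing with its central value to order higher than one. The radius
  -- `4 * M` is `2 * M` for `f x - f c` plus `2 * M` for the linear term.
  let g : E → F := fun x => f x - fderiv ℂ f c (x - c)
  have hgc : g c = f c := by simp [g]
  have hgd : DifferentiableOn ℂ g (ball c R) :=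
    hd.sub (((fderiv ℂ f c).differentiable.comp (differentiable_id.sub_const c)).differentiableOn)
  have hmaps : MapsTo g (ball c R) (closedBall (g c) (4 * M)) := by
    intro x hx
    rw [mem_closedBall, dist_eq_norm, hgc]
    have h1 : ‖fderiv ℂ f c (x - c)‖ ≤ 2 * M := by
      refine ((fderiv ℂ f c).le_of_opNorm_le hf' _).trans ?_
      rw [mem_ball, dist_eq_norm] at hx
      calc 2 * M / R * ‖x - c‖ ≤ 2 * M / R * R := by gcongr
        _ = 2 * M := by field_simp
    have h2 : g x - f c = f x - f c - fderiv ℂ f c (x - c) := by simp only [g]; abel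
    rw [h2]
    linarith [norm_sub_le (f x - f c) (fderiv ℂ f c (x - c)), norm_sub_le (f x) (f c), hM x hx,
      hM c (mem_ball_self hR)]
  have ho : (g · - g c) =o[𝓝 c] (fun w ↦ ‖w - c‖ ^ 1) := by
    simp only [pow_one]
    refine IsLittleO.norm_right ?_
    refine (hasFDerivAt_iff_isLittleO.1 hdc.hasFDerivAt).congr_left fun x => ?_
    rw [hgc]; simp only [g]; abel
  have := Complex.dist_le_mul_div_pow_of_mapsTo_ball_of_isLittleO (z := c + h) hgd hmaps ho
    (by simpa using hh)
  simpa [dist_eq_norm, g, sub_right_comm] using this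

/-- A uniform limit of holomorphic functions on a ball is holomorphic at its center. -/
theorem differentiableAt_of_tendstoUniformlyOn [CompleteSpace F] {ι : Type*} {l : Filter ι}
    [NeBot l] {f : ι → E → F} {g : E → F} {c : E} {R : ℝ} (hR : 0 < R)
    (hd : ∀ᶠ n in l, DifferentiableOn ℂ (f n) (ball c R))
    (hu : TendstoUniformlyOn f g l (ball c R)) : DifferentiableAt ℂ g c := by
  have hsub : ∀ y ∈ ball c (R / 2), ball y (R / 2) ⊆ ball c R := fun y hy =>
    ball_subset_ball' (by rw [mem_ball] at hy; linarith)
  have hC : UniformCauchySeqOn (fun n => fderiv ℂ (f n)) l (ball c (R / 2)) := by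
    intro u hu'
    obtain ⟨ε, hε, hεu⟩ := Metric.mem_uniformity_dist.1 hu'
    -- Two errors of `ε * R / 16` add up to `ε * R / 8`, which the Cauchy estimate at radius `R / 2`
    -- turns into `ε / 2`.
    have hu2 := Metric.tendstoUniformlyOn_iff.1 hu (ε * R / 16) (by positivity)
    have hprod := (hd.and hu2).prod_mk (hd.and hu2)
    filter_upwards [hprod] with m hm y hy
    apply hεu
    obtain ⟨⟨hd1, hu1⟩, hd2, hu2⟩ := hm
    have hyR : y ∈ ball c R := ball_subset_ball (by linarith) hy
    have hopen : ball c R ∈ 𝓝 y := isOpen_ball.mem_nhds hyR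
    have hbd : ∀ x ∈ ball y (R / 2), ‖(f m.1 - f m.2) x‖ ≤ ε * R / 8 := by
      intro x hx
      have h1 := hu1 x (hsub y hy hx)
      have h2 := hu2 x (hsub y hy hx)
      have h3 := dist_triangle_left (f m.1 x) (f m.2 x) (g x)
      rw [Pi.sub_apply, ← dist_eq_norm]
      linarith
    have := norm_fderiv_le_of_norm_le (half_pos hR) ((hd1.sub hd2).mono (hsub y hy)) hbd
    rw [fderiv_sub (hd1.differentiableAt hopen) (hd2.differentiableAt hopen)] at this
    rw [dist_eq_norm]
    refine this.trans_lt ?_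
    have : 2 * (ε * R / 8) / (R / 2) = ε / 2 := by field_simp; norm_num
    linarith
  have hlim : ∀ y, ∃ L : E →L[ℂ] F,
      y ∈ ball c (R / 2) → Tendsto (fun n => fderiv ℂ (f n) y) l (𝓝 L) := by
    intro y
    by_cases hy : y ∈ ball c (R / 2)
    · obtain ⟨L, hL⟩ := cauchy_iff_exists_le_nhds.1 (hC.cauchy_map hy)
      exact ⟨L, fun _ => hL⟩
    · exact ⟨0, fun h => absurd h hy⟩
  choose g' hg' using hlim
  have hunif := hC.tendstoUniformlyOn_of_tendsto hg'
  have hnhds : ball c (R / 2) ∈ 𝓝 c := ball_mem_nhds c (half_pos hR)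
  refine (hasFDerivAt_of_tendstoUniformlyOnFilter (f := f) (l := l) (g' := g')
    (f' := fun n => fderiv ℂ (f n)) ?_ ?_ ?_).differentiableAt
  · exact hunif.tendstoUniformlyOnFilter.mono_right (le_principal_iff.2 hnhds)
  · filter_upwards [hd.prod_mk (eventually_mem_set.2 hnhds)] with n hn
    exact (hn.1.differentiableAt
      (isOpen_ball.mem_nhds (ball_subset_ball (by linarith) hn.2))).hasFDerivAt
  · filter_upwards [hnhds] with y hy
    exact hu.tendsto_at (ball_subset_ball (by linarith) hy)

/-- Directional derivatives of a bounded holomorphic function are holomorphic. -/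
theorem differentiableAt_fderiv_apply [CompleteSpace F] {f : E → F} {c : E} {R M : ℝ} (hR : 0 < R)
    (hd : DifferentiableOn ℂ f (ball c R)) (hM : ∀ x ∈ ball c R, ‖f x‖ ≤ M) (v : E) :
    DifferentiableAt ℂ (fun y => fderiv ℂ f y v) c := by
  have hM0 : 0 ≤ M := (norm_nonneg _).trans (hM c (mem_ball_self hR))
  have hR2 : 0 < R / 2 := half_pos hR
  have hsub : ∀ y ∈ ball c (R / 2), ball y (R / 2) ⊆ ball c R := fun y hy =>
    ball_subset_ball' (by rw [mem_ball] at hy; linarith)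
  have htv : ∀ᶠ t : ℂ in 𝓝[≠] 0, t ≠ 0 ∧ ‖t • v‖ < R / 2 := by
    refine eventually_mem_nhdsWithin.and (eventually_nhdsWithin_of_eventually_nhds ?_)
    have : Tendsto (fun t : ℂ => ‖t • v‖) (𝓝 0) (𝓝 0) := by
      have h : Continuous (fun t : ℂ => ‖t • v‖) := by fun_prop
      simpa using h.tendsto 0
    exact this.eventually_lt_const hR2
  -- The difference quotients are holomorphic, and the quadratic remainder estimate makes their
  -- error `O(‖t‖)` uniformly on the half ball.
  refine differentiableAt_of_tendstoUniformlyOn (l := 𝓝[≠] (0 : ℂ))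
    (f := fun t y => t⁻¹ • (f (y + t • v) - f y)) hR2 ?_ ?_
  · filter_upwards [htv] with t ht
    refine DifferentiableOn.const_smul (DifferentiableOn.sub ?_ ?_) _
    · refine hd.comp (differentiable_id.add_const _).differentiableOn fun y hy => ?_
      exact hsub y hy (by simpa using ht.2)
    · exact hd.mono (ball_subset_ball (by linarith))
  · rw [Metric.tendstoUniformlyOn_iff]
    intro ε hε
    have hlim : Tendsto (fun t : ℂ => 4 * M * ‖t‖ * (‖v‖ / (R / 2)) ^ 2) (𝓝[≠] 0) (𝓝 0) := by
      have h : Continuous (fun t : ℂ => 4 * M * ‖t‖ * (‖v‖ / (R / 2)) ^ 2) := by fun_prop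
      simpa using (h.tendsto 0).mono_left nhdsWithin_le_nhds
    filter_upwards [htv, hlim.eventually_lt_const hε] with t ht hlt y hy
    refine lt_of_le_of_lt ?_ hlt
    have h1 := norm_sub_sub_fderiv_le hR2 (hd.mono (hsub y hy))
      (fun x hx => hM x (hsub y hy hx)) ht.2
    have ht0 : 0 < ‖t‖ := norm_pos_iff.2 ht.1
    have h2 : t⁻¹ • (f (y + t • v) - f y) - fderiv ℂ f y v
        = t⁻¹ • (f (y + t • v) - f y - fderiv ℂ f y (t • v)) := by
      rw [smul_sub t⁻¹ _ (fderiv ℂ f y (t • v)), map_smul, inv_smul_smul₀ ht.1]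
    rw [dist_comm, dist_eq_norm, h2, norm_smul, norm_inv]
    calc ‖t‖⁻¹ * ‖f (y + t • v) - f y - fderiv ℂ f y (t • v)‖
        ≤ ‖t‖⁻¹ * (4 * M * (‖t • v‖ / (R / 2)) ^ 2) := by gcongr
      _ = 4 * M * ‖t‖ * (‖v‖ / (R / 2)) ^ 2 := by
        rw [norm_smul]; field_simp

/-- The derivative of a bounded holomorphic function is holomorphic. -/
theorem differentiableAt_fderiv_of_norm_le [CompleteSpace F] {f : E → F} {c : E} {R M : ℝ}
    (hR : 0 < R) (hd : DifferentiableOn ℂ f (ball c R)) (hM : ∀ x ∈ ball c R, ‖f x‖ ≤ M) :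
    DifferentiableAt ℂ (fderiv ℂ f) c := by
  have hM0 : 0 ≤ M := (norm_nonneg _).trans (hM c (mem_ball_self hR))
  have hR2 : 0 < R / 2 := half_pos hR
  have hsub : ∀ y ∈ ball c (R / 2), ball y (R / 2) ⊆ ball c R := fun y hy =>
    ball_subset_ball' (by rw [mem_ball] at hy; linarith)
  have hdv : ∀ v : E, ∀ y ∈ ball c (R / 2), DifferentiableAt ℂ (fun y => fderiv ℂ f y v) y :=
    fun v y hy => differentiableAt_fderiv_apply hR2 (hd.mono (hsub y hy))
      (fun x hx => hM x (hsub y hy hx)) v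
  have hc : c ∈ ball c (R / 2) := mem_ball_self hR2
  set K : ℝ := 2 * M / (R / 2) with hK
  have hK0 : 0 ≤ K := by positivity
  have hbd : ∀ v : E, ∀ y ∈ ball c (R / 2), ‖fderiv ℂ f y v‖ ≤ K * ‖v‖ := fun v y hy =>
    (fderiv ℂ f y).le_of_opNorm_le (norm_fderiv_le_of_norm_le hR2 (hd.mono (hsub y hy))
      (fun x hx => hM x (hsub y hy hx))) v
  have hdon : ∀ v : E, DifferentiableOn ℂ (fun y => fderiv ℂ f y v) (ball c (R / 2)) :=
    fun v y hy => (hdv v y hy).differentiableWithinAt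
  -- The derivatives of `y ↦ fderiv ℂ f y v` assemble into the candidate second derivative. Their
  -- remainder bound is proportional to `‖v‖`, hence a bound in operator norm. `D` takes `v` before
  -- the increment, hence the later `flip`.
  let D : E →L[ℂ] E →L[ℂ] F := LinearMap.mkContinuous
    { toFun := fun v => fderiv ℂ (fun y => fderiv ℂ f y v) c
      map_add' := fun v w => by
        rw [← fderiv_add (hdv v c hc) (hdv w c hc)]
        congr 1
        ext y
        simp
      map_smul' := fun a v => by
        rw [RingHom.id_apply, ← fderiv_const_smul (hdv v c hc)]
        congr 1
        ext y
        simp } (2 * K / (R / 2)) fun v => by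
    refine (norm_fderiv_le_of_norm_le hR2 (hdon v) (hbd v)).trans_eq ?_
    ring
  have hDv : ∀ v, D v = fderiv ℂ (fun y => fderiv ℂ f y v) c := fun v => rfl
  refine HasFDerivAt.differentiableAt (f' := D.flip) ?_
  rw [hasFDerivAt_iff_isLittleO_nhds_zero]
  have hO : (fun h : E => fderiv ℂ f (c + h) - fderiv ℂ f c - D.flip h) =O[𝓝 0]
      fun h : E => ‖h‖ ^ 2 := by
    refine IsBigO.of_bound (4 * K / (R / 2) ^ 2) ?_
    filter_upwards [ball_mem_nhds (0 : E) hR2] with h hh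
    rw [mem_ball_zero_iff] at hh
    refine ContinuousLinearMap.opNorm_le_bound _ (by positivity) fun v => ?_
    have := norm_sub_sub_fderiv_le hR2 (hdon v) (hbd v) hh
    simp only [sub_apply, ContinuousLinearMap.flip_apply, hDv]
    refine this.trans_eq ?_
    rw [norm_pow, norm_norm]
    ring
  refine hO.trans_isLittleO ?_
  refine IsLittleO.of_norm_right ?_
  simpa using (isLittleO_norm_pow_id (E' := E) one_lt_two).norm_right

/-- Continuity supplies the local bound that the Cauchy estimates need. -/
theorem _root_.DifferentiableOn.fderiv_of_isOpen [CompleteSpace F] {f : E → F} {U : Set E}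
    (hd : DifferentiableOn ℂ f U) (hU : IsOpen U) : DifferentiableOn ℂ (fderiv ℂ f) U := by
  intro x hx
  have hcont : ContinuousAt f x := hd.continuousOn.continuousAt (hU.mem_nhds hx)
  have hev : ∀ᶠ y in 𝓝 x, ‖f y‖ < ‖f x‖ + 1 :=
    hcont.norm.eventually_lt continuousAt_const (lt_add_one _)
  obtain ⟨R, hR, hball⟩ := Metric.mem_nhds_iff.1 (hev.and (hU.mem_nhds hx))
  exact (differentiableAt_fderiv_of_norm_le hR (hd.mono fun y hy => (hball hy).2)
    fun y hy => (hball hy).1.le).differentiableWithinAt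

end Holomorphic

/-! ### Smoothness of holomorphic functions. -/

section Smooth

universe u

variable {E : Type u} [NormedAddCommGroup E] [NormedSpace ℂ E]

/-- The induction replaces `F` by `E →L[ℂ] F`, so both spaces must live in the same universe. -/
theorem contDiffOn_nat_of_differentiableOn {F : Type u} [NormedAddCommGroup F] [NormedSpace ℂ F]
    [CompleteSpace F] {f : E → F} {U : Set E} (hU : IsOpen U) (hd : DifferentiableOn ℂ f U)
    (n : ℕ) : ContDiffOn ℂ n f U := by
  induction n generalizing F with
  | zero => exact contDiffOn_zero.2 hd.continuousOn
  | succ n ih =>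
    push_cast
    rw [contDiffOn_succ_iff_fderiv_of_isOpen hU]
    exact ⟨hd, by simp, ih (hd.fderiv_of_isOpen hU)⟩

/-- A holomorphic function on an open subset of a complex normed space is smooth. -/
theorem contDiffOn_of_differentiableOn {f : E → ℂ} {U : Set E} (hU : IsOpen U)
    (hd : DifferentiableOn ℂ f U) (n : ℕ) : ContDiffOn ℂ n f U := by
  -- One derivative is split off first: `ℂ` lies in the lowest universe, whereas `E →L[ℂ] ℂ` lies in
  -- that of `E`.
  refine ContDiffOn.of_le (n := (n + 1 : ℕ)) ?_ (by exact_mod_cast n.le_succ)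
  push_cast
  rw [contDiffOn_succ_iff_fderiv_of_isOpen hU]
  exact ⟨hd, by simp, contDiffOn_nat_of_differentiableOn hU (hd.fderiv_of_isOpen hU) n⟩

end Smooth

/-! ### Symmetry of iterated derivatives and their values on the diagonal. -/

section IteratedDerivatives

universe u

variable {E : Type u} [NormedAddCommGroup E] [NormedSpace ℂ E]

theorem contDiffAt_iteratedFDeriv {f : E → ℂ} {U : Set E} (hU : IsOpen U)
    (hd : DifferentiableOn ℂ f U) {x : E} (hx : x ∈ U) (n m : ℕ) :
    ContDiffAt ℂ m (iteratedFDeriv ℂ n f) x :=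
  ((contDiffOn_of_differentiableOn hU hd (m + n)).contDiffAt (hU.mem_nhds hx)).iteratedFDeriv_right
    (by push_cast; exact le_rfl)

theorem differentiableAt_iteratedFDeriv {f : E → ℂ} {U : Set E} (hU : IsOpen U)
    (hd : DifferentiableOn ℂ f U) {x : E} (hx : x ∈ U) (n : ℕ) :
    DifferentiableAt ℂ (iteratedFDeriv ℂ n f) x :=
  (contDiffAt_iteratedFDeriv hU hd hx n 1).differentiableAt (by simp)

theorem fderiv_iteratedFDeriv_apply {f : E → ℂ} {U : Set E} (hU : IsOpen U)
    (hd : DifferentiableOn ℂ f U) {x : E} (hx : x ∈ U) (n : ℕ) (w : Fin n → E) (h : E) :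
    fderiv ℂ (fun y => iteratedFDeriv ℂ n f y w) x h = fderiv ℂ (iteratedFDeriv ℂ n f) x h w := by
  have h1 := (differentiableAt_iteratedFDeriv hU hd hx n).hasFDerivAt
  have h2 := (ContinuousMultilinearMap.apply ℂ (fun _ : Fin n => E) ℂ w).hasFDerivAt.comp x h1
  have h3 : fderiv ℂ (fun y => iteratedFDeriv ℂ n f y w) x
    = (ContinuousMultilinearMap.apply ℂ (fun _ : Fin n => E) ℂ w).comp
      (fderiv ℂ (iteratedFDeriv ℂ n f) x) := h2.fderiv
  rw [h3]
  rfl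

theorem fderiv_apply_fderiv_apply {G : Type*} [NormedAddCommGroup G] [NormedSpace ℂ G] {g : E → G}
    {x : E} (hg : DifferentiableAt ℂ (fderiv ℂ g) x) (L : G →L[ℂ] ℂ) (h w : E) :
    fderiv ℂ (fun y => L (fderiv ℂ g y w)) x h = L (fderiv ℂ (fderiv ℂ g) x h w) := by
  have h1 : HasFDerivAt (fun y => fderiv ℂ g y w)
      ((ContinuousLinearMap.apply ℂ G w).comp (fderiv ℂ (fderiv ℂ g) x)) x :=
    (ContinuousLinearMap.apply ℂ G w).hasFDerivAt.comp x hg.hasFDerivAt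
  exact DFunLike.congr_fun (L.hasFDerivAt.comp x h1).fderiv h

/-- The iterated derivatives of a holomorphic function are symmetric. -/
theorem iteratedFDeriv_comp_perm {f : E → ℂ} {U : Set E} (hU : IsOpen U)
    (hd : DifferentiableOn ℂ f U) (n : ℕ) (σ : Equiv.Perm (Fin n)) :
    ∀ x ∈ U, ∀ v : Fin n → E, iteratedFDeriv ℂ n f x (v ∘ σ) = iteratedFDeriv ℂ n f x v := by
  induction n with
  | zero => intro x _ v; congr 1; exact Subsingleton.elim _ _
  | succ n ih =>
    -- Adjacent transpositions generate the permutations. Swapping the first two slots is symmetry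
    -- of the second derivative of `iteratedFDeriv ℂ n f`. Any other swap fixes slot `0`, and
    -- differentiating the inductive identity near `x` gives it.
    have hσ : σ ∈ Submonoid.closure
        (Set.range fun i : Fin n => Equiv.swap i.castSucc i.succ) := by
      rw [Equiv.Perm.mclosure_swap_castSucc_succ]; trivial
    induction hσ using Submonoid.closure_induction with
    | one => intro x _ v; rfl
    | mul σ τ _ _ h1 h2 =>
      intro x hx v
      rw [Equiv.Perm.coe_mul, ← Function.comp_assoc, h2 x hx, h1 x hx]
    | mem σ hσ =>
      obtain ⟨i, rfl⟩ := hσ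
      intro x hx v
      obtain _ | n := n
      · exact i.elim0
      refine Fin.cases ?_ (fun j => ?_) i
      · have hsymm := ((contDiffAt_iteratedFDeriv hU hd hx n 2).isSymmSndFDerivAt
          (by simp)).eq
        have key : ∀ w : Fin (n + 2) → E, iteratedFDeriv ℂ (n + 2) f x w =
            fderiv ℂ (fderiv ℂ (iteratedFDeriv ℂ n f)) x (w 0) (w 1)
              (Fin.tail (Fin.tail w)) := by
          intro w
          rw [iteratedFDeriv_succ_apply_left, ← fderiv_iteratedFDeriv_apply hU hd hx]
          have h1 : (fun y => iteratedFDeriv ℂ (n + 1) f y (Fin.tail w)) = fun y =>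
              fderiv ℂ (iteratedFDeriv ℂ n f) y (w 1) (Fin.tail (Fin.tail w)) := by
            ext y
            rw [iteratedFDeriv_succ_apply_left]
            rfl
          have hdd : DifferentiableAt ℂ (fderiv ℂ (iteratedFDeriv ℂ n f)) x :=
            ((contDiffAt_iteratedFDeriv hU hd hx n 2).fderiv_right (m := 1)
              (by norm_num)).differentiableAt (by simp)
          rw [h1]
          exact fderiv_apply_fderiv_apply hdd
            (ContinuousMultilinearMap.apply ℂ (fun _ : Fin n => E) ℂ (Fin.tail (Fin.tail w)))
            (w 0) (w 1)
        rw [key, key, hsymm]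
        congr 1
      · have h0 : (v ∘ Equiv.swap j.succ.castSucc j.succ.succ) 0 = v 0 := by
          simp only [Function.comp]
          rw [Equiv.swap_apply_of_ne_of_ne]
          · rw [← Fin.succ_castSucc]
            exact (Fin.succ_ne_zero _).symm
          · exact (Fin.succ_ne_zero _).symm
        have h1 : Fin.tail (v ∘ Equiv.swap j.succ.castSucc j.succ.succ)
            = Fin.tail v ∘ Equiv.swap j.castSucc j.succ := by
          ext k
          simp only [Fin.tail, Function.comp]
          congr 1
          exact (Fin.succ_injective _).swap_apply j.castSucc j.succ k
        rw [iteratedFDeriv_succ_apply_left, iteratedFDeriv_succ_apply_left, h0, h1,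
          ← fderiv_iteratedFDeriv_apply hU hd hx, ← fderiv_iteratedFDeriv_apply hU hd hx]
        congr 1
        apply Filter.EventuallyEq.fderiv_eq
        filter_upwards [hU.mem_nhds hx] with y hy
        exact ih _ y hy _

/-- The Taylor coefficients at `0` along a line. -/
theorem iteratedDeriv_comp_smul {f : E → ℂ} {U : Set E} (hU : IsOpen U) (h0 : 0 ∈ U)
    (hd : DifferentiableOn ℂ f U) (n : ℕ) (x : E) :
    iteratedDeriv n (fun t : ℂ => f (t • x)) 0 = iteratedFDeriv ℂ n f 0 (fun _ => x) := by
  let g : ℂ →L[ℂ] E := ContinuousLinearMap.toSpanSingleton ℂ x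
  have hg0 : g 0 = 0 := map_zero g
  have hV : IsOpen (g ⁻¹' U) := hU.preimage g.continuous
  have h0V : (0 : ℂ) ∈ g ⁻¹' U := by rw [mem_preimage, hg0]; exact h0
  have := g.iteratedFDerivWithin_comp_right (contDiffOn_of_differentiableOn hU hd n)
    hU.uniqueDiffOn hV.uniqueDiffOn h0V (i := n) le_rfl
  rw [iteratedFDerivWithin_of_isOpen n hV h0V, iteratedFDerivWithin_of_isOpen n hU h0V, hg0] at this
  rw [iteratedDeriv_eq_iteratedFDeriv]
  have h1 : (fun t : ℂ => f (t • x)) = f ∘ g := by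
    ext t; simp [g]
  rw [h1, this]
  simp [ContinuousMultilinearMap.compContinuousLinearMap_apply, g]

end IteratedDerivatives

/-! ### Taylor series on the unit ball. -/

section Taylor

variable {X : Type*} [NormedAddCommGroup X] [NormedSpace ℂ X]

theorem norm_zeroExt_le (f : BallFun X) (x : X) : ‖zeroExt f x‖ ≤ ‖f‖ := by
  unfold zeroExt
  split_ifs with h
  · exact f.norm_coe_le_norm _
  · simp

/-- Cauchy's estimate for `t ↦ f (t • x)` on the disc of radius `s⁻¹`. For `s < 1` it is a summable
bound uniform in `x`. -/
theorem norm_taylor_term_le {f : BallFun X} (hf : f ∈ Hinf X) {s : ℝ} {x : X} (hxs : ‖x‖ < s)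
    (n : ℕ) :
    ‖((n.factorial : ℂ))⁻¹ * iteratedFDeriv ℂ n (zeroExt f) 0 (fun _ => x)‖ ≤ ‖f‖ * s ^ n := by
  have hs0 : 0 < s := (norm_nonneg x).trans_lt hxs
  have hmem : ∀ t ∈ closedBall (0 : ℂ) s⁻¹, t • x ∈ ball (0 : X) 1 := by
    intro t ht
    rw [mem_closedBall_zero_iff] at ht
    rw [mem_ball_zero_iff, norm_smul]
    calc ‖t‖ * ‖x‖ ≤ s⁻¹ * ‖x‖ := by gcongr
      _ < s⁻¹ * s := by gcongr
      _ = 1 := inv_mul_cancel₀ hs0.ne'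
  have hd : DifferentiableOn ℂ (fun t : ℂ => zeroExt f (t • x)) (closedBall 0 s⁻¹) :=
    DifferentiableOn.comp (t := ball (0 : X) 1) hf
      (differentiable_id.smul_const x).differentiableOn hmem
  have hdc : DiffContOnCl ℂ (fun t : ℂ => zeroExt f (t • x)) (ball 0 s⁻¹) :=
    (hd.mono closure_ball_subset_closedBall).diffContOnCl
  have := Complex.norm_iteratedDeriv_le_of_forall_mem_sphere_norm_le n (inv_pos.2 hs0) hdc
    (fun t _ => norm_zeroExt_le f (t • x))
  rw [iteratedDeriv_comp_smul isOpen_ball (mem_ball_self one_pos) hf] at this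
  have hn : (0 : ℝ) < n.factorial := by exact_mod_cast n.factorial_pos
  rw [norm_mul, norm_inv, Complex.norm_natCast]
  calc (n.factorial : ℝ)⁻¹ * ‖iteratedFDeriv ℂ n (zeroExt f) 0 fun _ => x‖
      ≤ (n.factorial : ℝ)⁻¹ * (n.factorial * ‖f‖ / s⁻¹ ^ n) := by gcongr
    _ = ‖f‖ * s ^ n := by rw [inv_pow, div_inv_eq_mul]; field_simp

/-- One-variable Taylor expansion along the line through `x`, on a disc of radius `s⁻¹ > 1`,
evaluated at `t = 1`. -/
theorem hasSum_taylor {f : BallFun X} (hf : f ∈ Hinf X) {x : X} (hx : ‖x‖ < 1) :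
    HasSum (fun n : ℕ => ((n.factorial : ℂ))⁻¹ * iteratedFDeriv ℂ n (zeroExt f) 0 (fun _ => x))
      (zeroExt f x) := by
  obtain ⟨s, hxs, hs1⟩ := exists_between hx
  have hs0 : 0 < s := (norm_nonneg x).trans_lt hxs
  have hmem : ∀ t ∈ ball (0 : ℂ) s⁻¹, t • x ∈ ball (0 : X) 1 := by
    intro t ht
    rw [mem_ball_zero_iff] at ht
    rw [mem_ball_zero_iff, norm_smul]
    calc ‖t‖ * ‖x‖ ≤ s⁻¹ * ‖x‖ := by gcongr
      _ < s⁻¹ * s := by gcongr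
      _ = 1 := inv_mul_cancel₀ hs0.ne'
  have hd : DifferentiableOn ℂ (fun t : ℂ => zeroExt f (t • x)) (ball 0 s⁻¹) :=
    DifferentiableOn.comp (t := ball (0 : X) 1) hf
      (differentiable_id.smul_const x).differentiableOn hmem
  have h1 : (1 : ℂ) ∈ ball (0 : ℂ) s⁻¹ := by
    simpa using (one_lt_inv₀ hs0).2 hs1
  have := Complex.hasSum_taylorSeries_on_ball hd h1
  simpa [iteratedDeriv_comp_smul isOpen_ball (mem_ball_self one_pos) hf] using this

end Taylor

/-! ### Goldstine's theorem by Hahn-Banach separation. -/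

section Goldstine

variable {X : Type*} [NormedAddCommGroup X] [NormedSpace ℂ X]

theorem mul_norm_le_of_re_le {l : StrongDual ℂ X} {r u : ℝ} (hr : 0 < r)
    (h : ∀ x ∈ closedBall (0 : X) r, (l x).re ≤ u) : r * ‖l‖ ≤ u := by
  have hu : 0 ≤ u := by simpa using h 0 (mem_closedBall_self hr.le)
  have hball : ∀ x ∈ closedBall (0 : X) r, ‖l x‖ ≤ u := by
    intro x hx
    obtain ⟨c, hc, hcl⟩ : ∃ c : ℂ, ‖c‖ = 1 ∧ c * l x = ‖l x‖ := by
      obtain ⟨c, hc, h⟩ := Complex.exists_norm_eq_mul_self (l x)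
      exact ⟨c, hc, h.symm⟩
    have := h (c • x) (by simpa [norm_smul, hc] using hx)
    simpa [hcl] using this
  rw [mul_comm, ← le_div_iff₀ hr]
  exact ContinuousLinearMap.opNorm_bound_of_ball_bound hr u l hball

/-- Hahn-Banach separation for the weak topology of a bilinear pairing, in terms of filters. -/
theorem exists_filter_tendsto_of_re_le {E F ι : Type*} [AddCommGroup E] [Module ℂ E]
    [AddCommGroup F] [Module ℂ F] (B : E →ₗ[ℂ] F →ₗ[ℂ] ℂ) (T : ι → E) {s : Set ι}
    (hs : Convex ℝ (T '' s)) {z : E}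
    (hz : ∀ (y : F) (u : ℝ), (∀ i ∈ s, (B (T i) y).re ≤ u) → (B z y).re ≤ u) :
    ∃ G : Filter ι, G.NeBot ∧ s ∈ G ∧ ∀ y : F, Tendsto (fun i => B (T i) y) G (𝓝 (B z y)) := by
  let T' : ι → WeakBilin B := T
  let z' : WeakBilin B := z
  have : ContinuousSMul ℝ (WeakBilin B) := IsScalarTower.continuousSMul ℂ
  have hs' : Convex ℝ (T' '' s) := hs
  have hmem : z' ∈ closure (T' '' s) := by
    -- A separating functional continuous for the weak topology of the pairing is `B · y` for some
    -- `y`, which contradicts `hz`.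
    by_contra hcon
    obtain ⟨g, u, h1, h2⟩ := RCLike.geometric_hahn_banach_closed_point (𝕜 := ℂ)
      hs'.closure isClosed_closure hcon
    obtain ⟨y, rfl⟩ := LinearMap.dualEmbedding_surjective B g
    exact absurd (hz y u fun i hi => (h1 _ (subset_closure (mem_image_of_mem T' hi))).le)
      (not_le.2 h2)
  refine ⟨comap T' (𝓝 z') ⊓ 𝓟 s, ?_, mem_inf_of_right (mem_principal_self s), fun y => ?_⟩
  · rw [← map_neBot_iff T', Filter.push_pull', map_principal]
    exact mem_closure_iff_clusterPt.1 hmem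
  · exact (((WeakBilin.eval_continuous B y).tendsto z').comp tendsto_comap).mono_left inf_le_left

/-- **Goldstine's theorem**, in terms of filters: a point of the bidual of norm less than `r` is a
weak-star limit of points of `X` of norm at most `r`. -/
theorem exists_filter_tendsto_bidual (z : StrongDual ℂ (StrongDual ℂ X)) {r : ℝ} (hz : ‖z‖ < r) :
    ∃ F : Filter X, F.NeBot ∧ (∀ᶠ x in F, ‖x‖ ≤ r) ∧
      ∀ l : StrongDual ℂ X, Tendsto (fun x => l x) F (𝓝 (z l)) := by
  have hr : 0 < r := (norm_nonneg z).trans_lt hz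
  have hconv : Convex ℝ (NormedSpace.inclusionInDoubleDual ℂ X '' closedBall 0 r) :=
    (convex_closedBall 0 r).is_linear_image
      ⟨fun x y => map_add _ x y, fun c x => by
        rw [← Complex.coe_smul, map_smul]; rfl⟩
  obtain ⟨G, hG, hball, hlim⟩ := exists_filter_tendsto_of_re_le
    (ContinuousLinearMap.coeLM ℂ : StrongDual ℂ (StrongDual ℂ X) →ₗ[ℂ] StrongDual ℂ X →ₗ[ℂ] ℂ)
    (NormedSpace.inclusionInDoubleDual ℂ X) hconv (z := z) fun l u h => by
      have h3 : r * ‖l‖ ≤ u := mul_norm_le_of_re_le hr h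
      have h4 : (z l).re ≤ ‖z‖ * ‖l‖ := (Complex.re_le_norm _).trans (z.le_opNorm l)
      change (z l).re ≤ u
      nlinarith [norm_nonneg l]
  refine ⟨G, hG, ?_, hlim⟩
  filter_upwards [hball] with x hx
  simpa using hx

end Goldstine

/-! ### Aron-Berner values as limits along arithmetic means. -/

section DavieGamelin

variable {X : Type*}

/-- The iterated filter `F ⊗ ⋯ ⊗ F` on `m`-tuples: a property holds eventually if it holds
eventually in the first variable, eventually in the second variable, and so on. -/
def iterFilter (F : Filter X) : (m : ℕ) → Filter (Fin m → X)
  | 0 => pure Fin.elim0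
  | m + 1 => F.bind fun x => (iterFilter F m).map fun v => (Fin.cons x v : Fin (m + 1) → X)

theorem eventually_iterFilter_succ {F : Filter X} {m : ℕ} {p : (Fin (m + 1) → X) → Prop} :
    (∀ᶠ v in iterFilter F (m + 1), p v) ↔
      ∀ᶠ x in F, ∀ᶠ v in iterFilter F m, p (Fin.cons x v) := by
  rw [iterFilter, eventually_bind]
  simp only [eventually_map]

instance iterFilter_neBot {F : Filter X} [F.NeBot] (m : ℕ) : (iterFilter F m).NeBot := by
  induction m with
  | zero => rw [iterFilter]; infer_instance
  | succ m ih =>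
    rw [← not_iff_not.2 (eventually_false_iff_eq_bot (f := iterFilter F (m + 1))) |>.trans
      neBot_iff.symm, eventually_iterFilter_succ]
    simp only [eventually_const, not_false_eq_true]

theorem eventually_iterFilter_forall {F : Filter X} {p : X → Prop} (h : ∀ᶠ x in F, p x) (m : ℕ) :
    ∀ᶠ v in iterFilter F m, ∀ i, p (v i) := by
  induction m with
  | zero => exact Eventually.of_forall fun v i => i.elim0
  | succ m ih =>
    rw [eventually_iterFilter_succ]
    filter_upwards [h] with x hx
    filter_upwards [ih] with v hv
    exact Fin.cases hx hv

variable [NormedAddCommGroup X] [NormedSpace ℂ X]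

/-- The Aron-Berner extension as an iterated limit. -/
theorem tendsto_iterFilter_of_strictMono {F : Filter X} {z : StrongDual ℂ (StrongDual ℂ X)}
    (hF : ∀ l : StrongDual ℂ X, Tendsto (fun x => l x) F (𝓝 (z l))) {m n : ℕ}
    (A : ContinuousMultilinearMap ℂ (fun _ : Fin n => X) ℂ) {i : Fin n → Fin m}
    (hi : StrictMono i) :
    Tendsto (fun v => A (v ∘ i)) (iterFilter F m) (𝓝 (aronBerner n (fun _ => z) A)) := by
  rw [Metric.tendsto_nhds]
  intro ε hε
  have hzero : ∀ (m : ℕ) (A : ContinuousMultilinearMap ℂ (fun _ : Fin 0 => X) ℂ)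
      (i : Fin 0 → Fin m) (ε : ℝ), 0 < ε → ∀ᶠ v in iterFilter F m,
        dist (A (v ∘ i)) (aronBerner 0 (fun _ => z) A) < ε := by
    intro m A i ε hε
    refine Eventually.of_forall fun v => ?_
    have : A (v ∘ i) = aronBerner 0 (fun _ => z) A := by
      change A (v ∘ i) = A 0
      congr 1
      exact Subsingleton.elim _ _
    rwa [this, dist_self]
  induction m generalizing n ε with
  | zero =>
    obtain _ | n := n
    · exact hzero 0 A i ε hε
    · exact (i 0).elim0
  | succ m ih =>
    obtain _ | n := n
    · exact hzero (m + 1) A i ε hε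
    rw [eventually_iterFilter_succ]
    -- If `i` uses the outermost variable, that limit is the action of `z` in the recursion for
    -- `aronBerner`; otherwise the variable is discarded.
    by_cases h0 : i 0 = 0
    · have hne : ∀ k : Fin n, i k.succ ≠ 0 := fun k => by
        rw [← h0]; exact (hi (Fin.succ_pos k)).ne'
      let i' : Fin n → Fin m := fun k => (i k.succ).pred (hne k)
      have hi' : StrictMono i' := fun a b hab => by
        simpa [i', Fin.pred_lt_pred_iff] using hi (Fin.succ_lt_succ_iff.2 hab)
      have hlim := Metric.tendsto_nhds.1
        (hF ((aronBerner n (fun _ => z)).comp A.curryLeft)) (ε / 2) (half_pos hε)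
      filter_upwards [hlim] with x hx
      filter_upwards [ih (A.curryLeft x) hi' (ε / 2) (half_pos hε)] with v hv
      have hv' : A ((Fin.cons x v : Fin (m + 1) → X) ∘ i) = A.curryLeft x (v ∘ i') := by
        rw [ContinuousMultilinearMap.curryLeft_apply]
        congr 1
        ext k
        refine Fin.cases ?_ (fun k => ?_) k
        · simp [h0]
        · have : i k.succ = (i' k).succ := by simp [i']
          simp [this]
      rw [hv', aronBerner_succ_apply]
      calc _ ≤ _ := dist_triangle _ (aronBerner n (fun _ => z) (A.curryLeft x)) _
        _ < ε / 2 + ε / 2 := add_lt_add hv hx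
        _ = ε := add_halves ε
    · have hne : ∀ k, i k ≠ 0 := fun k hk =>
        h0 (Fin.le_zero_iff.1 (hk ▸ hi.monotone (Fin.zero_le k)))
      let i' : Fin (n + 1) → Fin m := fun k => (i k).pred (hne k)
      have hi' : StrictMono i' := fun a b hab => by
        simpa [i', Fin.pred_lt_pred_iff] using hi hab
      refine Eventually.of_forall fun x => ?_
      filter_upwards [ih A hi' ε hε] with v hv
      have hv' : (Fin.cons x v : Fin (m + 1) → X) ∘ i = v ∘ i' := by
        ext k
        have : i k = (i' k).succ := by simp [i']
        simp [this]
      rwa [hv']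

/-- Symmetry of `A` lets the indices be sorted, so the order of the iterated limits no longer
matters. -/
theorem tendsto_iterFilter_of_injective {F : Filter X} {z : StrongDual ℂ (StrongDual ℂ X)}
    (hF : ∀ l : StrongDual ℂ X, Tendsto (fun x => l x) F (𝓝 (z l))) {m n : ℕ}
    {A : ContinuousMultilinearMap ℂ (fun _ : Fin n => X) ℂ}
    (hA : ∀ (σ : Equiv.Perm (Fin n)) (v : Fin n → X), A (v ∘ σ) = A v) {i : Fin n → Fin m}
    (hi : Function.Injective i) :
    Tendsto (fun v => A (v ∘ i)) (iterFilter F m) (𝓝 (aronBerner n (fun _ => z) A)) := by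
  have hmono : StrictMono (i ∘ Tuple.sort i) :=
    (Tuple.monotone_sort i).strictMono_of_injective (hi.comp (Equiv.injective _))
  refine (tendsto_iterFilter_of_strictMono hF A hmono).congr fun v => ?_
  rw [← Function.comp_assoc, hA]

/-- The arithmetic mean of a tuple. -/
def mean {m : ℕ} (v : Fin m → X) : X := (m : ℂ)⁻¹ • ∑ j, v j

theorem norm_mean_le {m : ℕ} {v : Fin m → X} {r : ℝ} (hr : 0 ≤ r) (hv : ∀ i, ‖v i‖ ≤ r) :
    ‖mean v‖ ≤ r := by
  rw [mean, norm_smul, norm_inv, Complex.norm_natCast]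
  have h1 : ‖∑ j, v j‖ ≤ m * r := by
    simpa using norm_sum_le_of_le Finset.univ fun i _ => hv i
  obtain rfl | hm := Nat.eq_zero_or_pos m
  · simpa using hr
  · have : (0 : ℝ) < m := by exact_mod_cast hm
    rwa [inv_mul_le_iff₀ this]

theorem map_mean {m n : ℕ} (A : ContinuousMultilinearMap ℂ (fun _ : Fin n => X) ℂ)
    (v : Fin m → X) :
    A (fun _ => mean v) = ((m : ℂ) ^ n)⁻¹ * ∑ i : Fin n → Fin m, A (v ∘ i) := by
  unfold mean
  rw [A.map_smul_univ (fun _ => (m : ℂ)⁻¹) (fun _ => ∑ j, v j), A.map_sum (fun _ j => v j)]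
  simp [Function.comp_def]

theorem card_injective (m n : ℕ) :
    (Finset.univ.filter fun i : Fin n → Fin m => Function.Injective i).card
      = m.descFactorial n := by
  rw [← Fintype.card_subtype, Fintype.card_congr (Equiv.subtypeInjectiveEquivEmbedding _ _),
    Fintype.card_embedding_eq, Fintype.card_fin, Fintype.card_fin]

theorem tendsto_descFactorial_div_pow (n : ℕ) :
    Tendsto (fun m : ℕ => (m.descFactorial n : ℝ) / (m : ℝ) ^ n) atTop (𝓝 1) := by
  refine (isEquivalent_iff_tendsto_one ?_).1 (isEquivalent_descFactorial n)
  filter_upwards [eventually_gt_atTop 0] with m hm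
  positivity

/-- Values at arithmetic means approximate the canonical extension. -/
theorem dist_map_mean_le {m n : ℕ} (hm : 0 < m)
    (A : ContinuousMultilinearMap ℂ (fun _ : Fin n => X) ℂ) {v : Fin m → X} {L : ℂ} {ε C : ℝ}
    (hinj : ∀ i : Fin n → Fin m, Function.Injective i → dist (A (v ∘ i)) L ≤ ε)
    (hall : ∀ i : Fin n → Fin m, dist (A (v ∘ i)) L ≤ C) (hε : 0 ≤ ε) :
    dist (A fun _ => mean v) L ≤ ε + (1 - (m.descFactorial n : ℝ) / (m : ℝ) ^ n) * C := by
  classical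
  have hm' : (0 : ℝ) < (m : ℝ) ^ n := by positivity
  have hmC : (m : ℂ) ^ n ≠ 0 := by
    have : (m : ℂ) ≠ 0 := by exact_mod_cast hm.ne'
    positivity
  have h1 : (A fun _ => mean v) - L =
      ((m : ℂ) ^ n)⁻¹ * ∑ i : Fin n → Fin m, (A (v ∘ i) - L) := by
    rw [Finset.sum_sub_distrib, mul_sub, ← map_mean]
    simp [hmC]
  -- Injective index maps cost `ε`, the others `ε + C`; there are `m.descFactorial n` injective ones
  -- among `m ^ n`.
  have h2 : ∀ i : Fin n → Fin m, ‖A (v ∘ i) - L‖ ≤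
      ε + (C - if Function.Injective i then C else 0) := by
    intro i
    rw [← dist_eq_norm]
    split_ifs with h
    · simpa using hinj i h
    · linarith [hall i]
  rw [dist_eq_norm, h1, norm_mul, norm_inv, norm_pow, Complex.norm_natCast,
    inv_mul_le_iff₀ hm']
  refine (norm_sum_le_of_le _ fun i _ => h2 i).trans_eq ?_
  rw [Finset.sum_add_distrib, Finset.sum_sub_distrib, ← Finset.sum_filter, Finset.sum_const,
    Finset.sum_const, Finset.sum_const, card_injective]
  simp only [Finset.card_univ, Fintype.card_fun, Fintype.card_fin, nsmul_eq_mul, Nat.cast_pow]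
  field_simp

/-- **Davie-Gamelin**: points of the open unit ball of the bidual are limits of points of `X` for
the topology given by all homogeneous polynomials. -/
theorem exists_filter_tendsto_aronBerner (z : StrongDual ℂ (StrongDual ℂ X)) {r : ℝ}
    (hz : ‖z‖ < r) :
    ∃ G : Filter X, G.NeBot ∧ (∀ᶠ x in G, ‖x‖ ≤ r) ∧
      ∀ (n : ℕ) (A : ContinuousMultilinearMap ℂ (fun _ : Fin n => X) ℂ),
        (∀ (σ : Equiv.Perm (Fin n)) (v : Fin n → X), A (v ∘ σ) = A v) →
          Tendsto (fun x => A fun _ => x) G (𝓝 (aronBerner n (fun _ => z) A)) := by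
  have hr : 0 ≤ r := (norm_nonneg z).trans hz.le
  obtain ⟨F, hFne, hFr, hF⟩ := exists_filter_tendsto_bidual z hz
  have hev : ∀ p : X → Prop, (∀ᶠ x in (atTop : Filter ℕ).bind fun m => (iterFilter F m).map mean,
      p x) ↔ ∀ᶠ m in atTop, ∀ᶠ v in iterFilter F m, p (mean v) := by
    intro p
    rw [eventually_bind]
    simp only [eventually_map]
  -- For `m` large, the points are means of `m`-tuples chosen eventually along the iterated filter.
  refine ⟨(atTop : Filter ℕ).bind fun m => (iterFilter F m).map mean, ?_, ?_, ?_⟩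
  · rw [neBot_iff, Ne, ← eventually_false_iff_eq_bot, hev]
    simp only [eventually_const, not_false_eq_true]
  · rw [hev]
    refine Eventually.of_forall fun m => ?_
    filter_upwards [eventually_iterFilter_forall hFr m] with v hv
    exact norm_mean_le hr hv
  · intro n A hA
    rw [Metric.tendsto_nhds]
    intro ε hε
    rw [hev]
    set L := aronBerner n (fun _ => z) A
    set C : ℝ := ‖A‖ * r ^ n + ‖L‖
    have hlim : Tendsto (fun m : ℕ => ε / 2 + (1 - (m.descFactorial n : ℝ) / (m : ℝ) ^ n) * C)
        atTop (𝓝 (ε / 2 + (1 - 1) * C)) :=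
      tendsto_const_nhds.add ((tendsto_const_nhds.sub (tendsto_descFactorial_div_pow n)).mul_const C)
    have hlt : ε / 2 + (1 - 1) * C < ε := by linarith
    filter_upwards [hlim.eventually_lt_const hlt, eventually_gt_atTop 0] with m hmε hm
    have hinj : ∀ᶠ v in iterFilter F m, ∀ i : Fin n → Fin m, Function.Injective i →
        dist (A (v ∘ i)) L ≤ ε / 2 := by
      rw [eventually_all]
      intro i
      rw [eventually_imp_distrib_left]
      intro hi
      filter_upwards [Metric.tendsto_nhds.1 (tendsto_iterFilter_of_injective hF hA hi) (ε / 2)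
        (half_pos hε)] with v hv using hv.le
    filter_upwards [hinj, eventually_iterFilter_forall hFr m] with v hv hvr
    refine (dist_map_mean_le hm A hv (fun i => ?_) (half_pos hε).le).trans_lt hmε
    rw [dist_eq_norm]
    refine (norm_sub_le _ _).trans ?_
    refine add_le_add ((A.le_opNorm _).trans ?_) le_rfl
    refine mul_le_mul_of_nonneg_left ?_ (norm_nonneg A)
    refine (Finset.prod_le_prod (fun k _ => norm_nonneg _) fun k _ => hvr (i k)).trans_eq ?_
    simp

end DavieGamelin

/-! ### Schwarz-Pick from the centre of the ball. -/

section SchwarzPick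

variable {X : Type*} [NormedAddCommGroup X] [NormedSpace ℂ X]

/-- The difference of the squares is `(1 - ‖a‖ ^ 2) * (1 - ‖w‖ ^ 2)`. -/
theorem norm_sub_le_norm_one_sub_conj_mul {a w : ℂ} (ha : ‖a‖ ≤ 1) (hw : ‖w‖ ≤ 1) :
    ‖w - a‖ ≤ ‖1 - (starRingEnd ℂ) a * w‖ := by
  have ha2 : ‖a‖ ^ 2 ≤ 1 := pow_le_one₀ (norm_nonneg a) ha
  have hw2 : ‖w‖ ^ 2 ≤ 1 := pow_le_one₀ (norm_nonneg w) hw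
  refine le_of_sq_le_sq ?_ (norm_nonneg _)
  rw [Complex.sq_norm, Complex.normSq_apply] at ha2 hw2 ⊢
  rw [Complex.sq_norm, Complex.normSq_apply]
  simp only [Complex.sub_re, Complex.sub_im, Complex.mul_re, Complex.mul_im, Complex.conj_re,
    Complex.conj_im, Complex.one_re, Complex.one_im]
  nlinarith [mul_nonneg (sub_nonneg.2 ha2) (sub_nonneg.2 hw2)]

/-- **Schwarz-Pick** for the unit ball, from the origin. -/
theorem norm_sub_le_norm_mul_of_lt {f : X → ℂ} (hd : DifferentiableOn ℂ f (ball 0 1))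
    (hf : ∀ x ∈ ball (0 : X) 1, ‖f x‖ ≤ 1) (hf0 : ‖f 0‖ < 1) {x : X} (hx : x ∈ ball (0 : X) 1) :
    ‖f x - f 0‖ ≤ ‖x‖ * ‖1 - (starRingEnd ℂ) (f 0) * f x‖ := by
  have hne : ∀ y ∈ ball (0 : X) 1, 1 - (starRingEnd ℂ) (f 0) * f y ≠ 0 := by
    intro y hy h
    have h1 : ‖(starRingEnd ℂ) (f 0) * f y‖ = 1 := by rw [← sub_eq_zero.1 h, norm_one]
    rw [norm_mul, RCLike.norm_conj] at h1
    nlinarith [hf y hy, norm_nonneg (f 0), norm_nonneg (f y)]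
  -- A Möbius map moves `f 0` to `0`, so Schwarz's lemma applies.
  let g : X → ℂ := fun y => (f y - f 0) / (1 - (starRingEnd ℂ) (f 0) * f y)
  have hgd : DifferentiableOn ℂ g (ball 0 1) :=
    ((hd.sub_const (f 0)).mul (((hd.const_mul _).const_sub 1).inv hne)).congr
      fun y _ => div_eq_mul_inv _ _
  have hmaps : MapsTo g (ball 0 1) (closedBall 0 1) := by
    intro y hy
    rw [mem_closedBall_zero_iff, norm_div]
    exact div_le_one_of_le₀ (norm_sub_le_norm_one_sub_conj_mul hf0.le (hf y hy)) (norm_nonneg _)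
  have := Complex.norm_le_norm_of_mapsTo_ball hgd hmaps (by simp [g]) (mem_ball_zero_iff.1 hx)
  rwa [norm_div, div_le_iff₀ (norm_pos_iff.2 (hne x hx))] at this

/-- The case `‖f 0‖ = 1` follows by applying the strict case to `t * f` and letting `t` increase to
`1`. -/
theorem norm_sub_le_norm_mul {f : X → ℂ} (hd : DifferentiableOn ℂ f (ball 0 1))
    (hf : ∀ x ∈ ball (0 : X) 1, ‖f x‖ ≤ 1) {x : X} (hx : x ∈ ball (0 : X) 1) :
    ‖f x - f 0‖ ≤ ‖x‖ * ‖1 - (starRingEnd ℂ) (f 0) * f x‖ := by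
  have hev : ∀ᶠ t : ℝ in 𝓝[<] 1, ‖(t : ℂ) * f x - t * f 0‖ ≤
      ‖x‖ * ‖1 - (starRingEnd ℂ) (t * f 0) * (t * f x)‖ := by
    filter_upwards [Ioo_mem_nhdsLT zero_lt_one] with t ht
    have hn : ∀ y ∈ ball (0 : X) 1, ‖(t : ℂ) * f y‖ ≤ t := fun y hy => by
      rw [norm_mul, Complex.norm_real, Real.norm_of_nonneg ht.1.le]
      exact mul_le_of_le_one_right ht.1.le (hf y hy)
    exact norm_sub_le_norm_mul_of_lt (f := fun y => (t : ℂ) * f y) (hd.const_mul _)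
      (fun y hy => (hn y hy).trans ht.2.le) ((hn 0 (mem_ball_self one_pos)).trans_lt ht.2) hx
  refine le_of_tendsto_of_tendsto ?_ ?_ hev
  · have h : Continuous fun t : ℝ => ‖(t : ℂ) * f x - t * f 0‖ := by fun_prop
    simpa using (h.tendsto 1).mono_left nhdsWithin_le_nhds
  · have h : Continuous fun t : ℝ =>
        ‖x‖ * ‖1 - (starRingEnd ℂ) (t * f 0) * (t * f x)‖ := by fun_prop
    simpa using (h.tendsto 1).mono_left nhdsWithin_le_nhds

end SchwarzPick

/-! ### Limits of evaluations and the Gleason part of `δ_0`. -/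

section Characters

variable {X : Type*} [NormedAddCommGroup X] [NormedSpace ℂ X]

theorem zeroExt_zero_eq_deltaZero {𝒜 : Subalgebra ℂ (BallFun X)} (f : 𝒜) :
    zeroExt (f : BallFun X) 0 = deltaZero 𝒜 f :=
  zeroExt_of_mem _ (mem_ball_self one_pos)

/-- A pointwise limit of evaluations at points of a smaller ball is a point of the Gleason part of
the evaluation at the origin. -/
theorem exists_mem_gleasonPart_of_tendsto {𝒜 : Subalgebra ℂ (BallFun X)} (h𝒜 : 𝒜 ≤ Hinf X)
    {G : Filter X} [G.NeBot] {r : ℝ} (hr : r < 1) (hG : ∀ᶠ x in G, ‖x‖ ≤ r) {Φ : 𝒜 → ℂ}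
    (hΦ : ∀ f : 𝒜, Tendsto (zeroExt (f : BallFun X)) G (𝓝 (Φ f))) :
    ∃ φ ∈ gleasonPart (deltaZero 𝒜), ∀ f, φ f = Φ f := by
  have hball : ∀ᶠ x in G, x ∈ ball (0 : X) 1 := by
    filter_upwards [hG] with x hx
    exact mem_ball_zero_iff.2 (hx.trans_lt hr)
  have hadd : ∀ f g, Φ (f + g) = Φ f + Φ g := fun f g => by
    refine tendsto_nhds_unique (hΦ (f + g)) (((hΦ f).add (hΦ g)).congr' ?_)
    filter_upwards [hball] with x hx
    simp [zeroExt_of_mem _ hx]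
  have hmul : ∀ f g, Φ (f * g) = Φ f * Φ g := fun f g => by
    refine tendsto_nhds_unique (hΦ (f * g)) (((hΦ f).mul (hΦ g)).congr' ?_)
    filter_upwards [hball] with x hx
    simp [zeroExt_of_mem _ hx]
  have hsmul : ∀ (c : ℂ) f, Φ (c • f) = c • Φ f := fun c f => by
    refine tendsto_nhds_unique (hΦ (c • f)) (((hΦ f).const_smul c).congr' ?_)
    filter_upwards [hball] with x hx
    simp [zeroExt_of_mem _ hx]
  have hone : Φ 1 = 1 := by
    refine tendsto_nhds_unique (hΦ 1) (tendsto_const_nhds.congr' ?_)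
    filter_upwards [hball] with x hx
    simp [zeroExt_of_mem _ hx]
  have hnorm : ∀ f, ‖Φ f‖ ≤ 1 * ‖f‖ := fun f => by
    rw [one_mul]
    exact le_of_tendsto (hΦ f).norm (Eventually.of_forall fun x => norm_zeroExt_le _ x)
  let φ' : StrongDual ℂ 𝒜 := LinearMap.mkContinuous
    { toFun := Φ, map_add' := hadd, map_smul' := hsmul } 1 hnorm
  let φ : WeakDual.characterSpace ℂ 𝒜 := ⟨StrongDual.toWeakDual φ', fun h => by
    have : Φ 1 = 0 := DFunLike.congr_fun h (1 : 𝒜)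
    exact one_ne_zero (hone ▸ this), hmul⟩
  have hφ : ∀ f, φ f = Φ f := fun f => rfl
  refine ⟨φ, ?_, hφ⟩
  have hr0 : 0 ≤ r := by
    obtain ⟨x, hx⟩ := hG.exists
    exact (norm_nonneg x).trans hx
  refine lt_of_le_of_lt (Real.sSup_le ?_ hr0) hr
  rintro _ ⟨f, hf1, hf0, rfl⟩
  rw [← zeroExt_zero_eq_deltaZero]
  rw [hφ] at hf0
  have hlim := hΦ f
  rw [hf0] at hlim
  -- As `f x → 0`, the left side tends to `‖f 0‖` and the right side to `r`.
  have hev : ∀ᶠ x in G, ‖zeroExt (f : BallFun X) x - zeroExt (f : BallFun X) 0‖ ≤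
      r * ‖1 - (starRingEnd ℂ) (zeroExt (f : BallFun X) 0) * zeroExt (f : BallFun X) x‖ := by
    filter_upwards [hG, hball] with x hxr hx
    refine (norm_sub_le_norm_mul (h𝒜 f.2) (fun y _ => (norm_zeroExt_le _ y).trans hf1) hx).trans ?_
    gcongr
  have := le_of_tendsto_of_tendsto (hlim.sub_const _).norm
    (((hlim.const_mul _).const_sub 1).norm.const_mul r) hev
  simpa using this

end Characters

/-! ### The characters `δ_z`. -/

section Delta

variable {X : Type*} [NormedAddCommGroup X] [NormedSpace ℂ X]

/-- Dominated convergence for the Taylor series: each term converges by `hlim`, and the Cauchy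
bounds form a geometric series. -/
theorem tendsto_zeroExt_canonicalExt {f : BallFun X} (hf : f ∈ Hinf X)
    {z : StrongDual ℂ (StrongDual ℂ X)} {G : Filter X} {r : ℝ} (hr : r < 1)
    (hG : ∀ᶠ x in G, ‖x‖ ≤ r)
    (hlim : ∀ (n : ℕ) (A : ContinuousMultilinearMap ℂ (fun _ : Fin n => X) ℂ),
      (∀ (σ : Equiv.Perm (Fin n)) (v : Fin n → X), A (v ∘ σ) = A v) →
        Tendsto (fun x => A fun _ => x) G (𝓝 (aronBerner n (fun _ => z) A))) :
    Tendsto (zeroExt f) G (𝓝 (canonicalExt f z)) := by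
  obtain ⟨s, hrs, hs1⟩ : ∃ s, max r 0 < s ∧ s < 1 := exists_between (max_lt hr one_pos)
  have hs0 : 0 ≤ s := (le_max_right r 0).trans hrs.le
  have h1 : Tendsto (fun x => ∑' n : ℕ, ((n.factorial : ℂ))⁻¹ *
      iteratedFDeriv ℂ n (zeroExt f) 0 (fun _ => x)) G (𝓝 (canonicalExt f z)) := by
    refine tendsto_tsum_of_dominated_convergence (bound := fun n => ‖f‖ * s ^ n)
      ((summable_geometric_of_lt_one hs0 hs1).mul_left _) (fun n => ?_) ?_
    · exact (hlim n _ fun σ v => iteratedFDeriv_comp_perm isOpen_ball hf n σ 0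
        (mem_ball_self one_pos) v).const_mul _
    · filter_upwards [hG] with x hx n
      exact norm_taylor_term_le hf ((hx.trans (le_max_left r 0)).trans_lt hrs) n
  refine h1.congr' ?_
  filter_upwards [hG] with x hx
  exact (hasSum_taylor hf (hx.trans_lt hr)).tsum_eq

theorem aronBerner_one_ofSubsingleton (z : StrongDual ℂ (StrongDual ℂ X)) (l : StrongDual ℂ X) :
    aronBerner 1 (fun _ => z) (ContinuousMultilinearMap.ofSubsingleton ℂ X ℂ (0 : Fin 1) l)
      = z l :=
  rfl

theorem canonicalExt_dualRestrict {z : StrongDual ℂ (StrongDual ℂ X)} (hz : ‖z‖ < 1)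
    (l : StrongDual ℂ X) : canonicalExt (dualRestrict l) z = z l := by
  obtain ⟨r, hzr, hr⟩ := exists_between hz
  obtain ⟨G, hne, hG, hlim⟩ := exists_filter_tendsto_aronBerner z hzr
  have h1 := tendsto_zeroExt_canonicalExt (dualRestrict_mem_Au l).1 hr hG hlim
  have h2 := hlim 1 (ContinuousMultilinearMap.ofSubsingleton ℂ X ℂ (0 : Fin 1) l) fun σ v => by
    rw [Subsingleton.elim σ 1]; rfl
  rw [aronBerner_one_ofSubsingleton] at h2
  refine tendsto_nhds_unique h1 (h2.congr' ?_)
  filter_upwards [hG] with x hx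
  rw [zeroExt_of_mem _ (mem_ball_zero_iff.2 (hx.trans_lt hr))]
  rfl

theorem canonicalExt_zero (f : BallFun X) : canonicalExt f 0 = zeroExt f 0 := by
  rw [canonicalExt, tsum_eq_single 0]
  · change ((Nat.factorial 0 : ℕ) : ℂ)⁻¹ * iteratedFDeriv ℂ 0 (zeroExt f) 0 0 = _
    simp
  · intro n hn
    obtain ⟨n, rfl⟩ := Nat.exists_eq_succ_of_ne_zero hn
    rw [aronBerner_succ_apply]
    simp

theorem exists_mem_gleasonPart_eq_delta {𝒜 : Subalgebra ℂ (BallFun X)} (h𝒜 : 𝒜 ≤ Hinf X)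
    {z : StrongDual ℂ (StrongDual ℂ X)} (hz : ‖z‖ < 1) :
    ∃ φ ∈ gleasonPart (deltaZero 𝒜), ∀ f, φ f = delta 𝒜 z f := by
  obtain ⟨r, hzr, hr⟩ := exists_between hz
  obtain ⟨G, hne, hG, hlim⟩ := exists_filter_tendsto_aronBerner z hzr
  exact exists_mem_gleasonPart_of_tendsto h𝒜 hr hG fun f =>
    tendsto_zeroExt_canonicalExt (h𝒜 f.2) hr hG hlim

theorem delta_dualIncl {𝒜 : Subalgebra ℂ (BallFun X)} (h𝒜 : Au X ≤ 𝒜)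
    {z : StrongDual ℂ (StrongDual ℂ X)} (hz : ‖z‖ < 1) (l : StrongDual ℂ X) :
    delta 𝒜 z (dualIncl 𝒜 h𝒜 l) = z l :=
  canonicalExt_dualRestrict hz l

end Delta

/-! ### Homogeneous parts of a polynomial around a point. -/

section Polynomials

theorem norm_piecewise_le {X : Type*} [NormedAddCommGroup X] {k : ℕ} (S : Finset (Fin k))
    {x₀ y : X} (hx₀ : ‖x₀‖ ≤ 1) (hy : ‖y‖ ≤ 1) :
    ‖(S.piecewise (fun _ => x₀) fun _ => y : Fin k → X)‖ ≤ 1 := by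
  refine (pi_norm_le_iff_of_nonneg zero_le_one).2 fun i => ?_
  by_cases hi : i ∈ S
  · simpa [hi] using hx₀
  · simpa [hi] using hy

variable {X : Type*} [NormedAddCommGroup X] [NormedSpace ℂ X]

/-- The polynomial `y ↦ A (x₀, …, x₀, y, …, y)`, with `x₀` in the places of `S`. -/
def partialDiag {k : ℕ} (A : ContinuousMultilinearMap ℂ (fun _ : Fin k => X) ℂ)
    (S : Finset (Fin k)) (x₀ y : X) : ℂ :=
  A (S.piecewise (fun _ => x₀) fun _ => y)

variable {k : ℕ} (A : ContinuousMultilinearMap ℂ (fun _ : Fin k => X) ℂ) (S : Finset (Fin k))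
  (x₀ : X)

theorem differentiable_partialDiag : Differentiable ℂ (partialDiag A S x₀) := by
  have h1 : Differentiable ℂ A := A.contDiff.differentiable one_ne_zero
  refine h1.comp (differentiable_pi.2 fun i => ?_)
  by_cases hi : i ∈ S
  · simp [hi]
  · simp [hi, differentiable_fun_id]

theorem norm_partialDiag_le {y : X} (hx₀ : ‖x₀‖ ≤ 1) (hy : ‖y‖ ≤ 1) :
    ‖partialDiag A S x₀ y‖ ≤ ‖A‖ := by
  refine (A.le_opNorm_mul_pow_card_of_le (norm_piecewise_le S hx₀ hy)).trans_eq ?_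
  simp

theorem norm_partialDiag_sub_le {y y' : X} (hx₀ : ‖x₀‖ ≤ 1) (hy : ‖y‖ ≤ 1) (hy' : ‖y'‖ ≤ 1) :
    ‖partialDiag A S x₀ y - partialDiag A S x₀ y'‖ ≤ ‖A‖ * k * ‖y - y'‖ := by
  have h1 := A.norm_image_sub_le (S.piecewise (fun _ => x₀) fun _ => y)
    (S.piecewise (fun _ => x₀) fun _ => y')
  have h2 : ‖(S.piecewise (fun _ => x₀) fun _ => y : Fin k → X) -
      S.piecewise (fun _ => x₀) fun _ => y'‖ ≤ ‖y - y'‖ := by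
    refine (pi_norm_le_iff_of_nonneg (norm_nonneg _)).2 fun i => ?_
    by_cases hi : i ∈ S <;> simp [hi]
  have h3 := norm_piecewise_le S hx₀ hy
  have h4 := norm_piecewise_le S hx₀ hy'
  refine h1.trans ?_
  rw [Fintype.card_fin]
  have h5 := pow_le_one₀ (n := k - 1) (le_max_of_le_left (norm_nonneg _)) (max_le h3 h4)
  calc _ ≤ ‖A‖ * k * 1 * ‖y - y'‖ := by gcongr
    _ = _ := by ring

theorem partialDiag_smul (c : ℂ) (y : X) :
    partialDiag A S x₀ (c • y) = c ^ (Sᶜ).card * partialDiag A S x₀ y := by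
  have h := A.map_smul_univ (S.piecewise (fun _ => 1) fun _ => c)
    (S.piecewise (fun _ => x₀) fun _ => y)
  have h1 : (S.piecewise (fun _ => x₀) fun _ => c • y : Fin k → X) = fun i =>
      (S.piecewise (fun _ => 1) fun _ => c : Fin k → ℂ) i •
        (S.piecewise (fun _ => x₀) fun _ => y : Fin k → X) i := by
    ext i
    by_cases hi : i ∈ S <;> simp [hi]
  rw [partialDiag, h1, h, smul_eq_mul, Finset.prod_piecewise]
  simp [partialDiag, Finset.compl_eq_univ_sdiff]

theorem partialDiag_zero (hS : S ≠ Finset.univ) : partialDiag A S x₀ 0 = 0 := by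
  obtain ⟨i, hi⟩ : ∃ i, i ∉ S := by
    by_contra! h
    exact hS (Finset.eq_univ_iff_forall.2 h)
  exact A.map_coord_zero i (by simp [hi])

/-- The restriction of `partialDiag` to the unit ball. -/
def partialDiagBall (hx₀ : ‖x₀‖ ≤ 1) : BallFun X :=
  BoundedContinuousFunction.ofNormedAddCommGroup (fun y : ball (0 : X) 1 => partialDiag A S x₀ y)
    ((differentiable_partialDiag A S x₀).continuous.comp continuous_subtype_val) ‖A‖ fun y =>
      norm_partialDiag_le A S x₀ hx₀ (mem_ball_zero_iff.1 y.2).le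

theorem zeroExt_partialDiagBall (hx₀ : ‖x₀‖ ≤ 1) {y : X} (hy : y ∈ ball (0 : X) 1) :
    zeroExt (partialDiagBall A S x₀ hx₀) y = partialDiag A S x₀ y := by
  rw [zeroExt_of_mem _ hy]
  rfl

theorem partialDiagBall_mem_Au (hx₀ : ‖x₀‖ ≤ 1) : partialDiagBall A S x₀ hx₀ ∈ Au X := by
  refine ⟨(differentiable_partialDiag A S x₀).differentiableOn.congr fun y hy =>
    zeroExt_partialDiagBall A S x₀ hx₀ hy, ?_⟩
  refine (LipschitzWith.of_dist_le_mul (K := ⟨‖A‖ * k, by positivity⟩) fun y y' => ?_ :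
    LipschitzWith _ (partialDiagBall A S x₀ hx₀)).uniformContinuous
  rw [dist_eq_norm, Subtype.dist_eq, dist_eq_norm]
  exact norm_partialDiag_sub_le A S x₀ hx₀ (mem_ball_zero_iff.1 y.2).le
    (mem_ball_zero_iff.1 y'.2).le

/-- Binomial expansion at `x₀`: if a polynomial is discontinuous at `x₀` along a filter, then so is
one of its homogeneous parts around `x₀`. -/
theorem exists_partialDiag_not_tendsto {P : X → ℂ} (hP : IsContinuousPolynomial P) {ι : Type*}
    {l : Filter ι} {x : ι → X} {x₀ : X} (h : ¬ Tendsto (fun i => P (x i)) l (𝓝 (P x₀))) :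
    ∃ (k : ℕ) (A : ContinuousMultilinearMap ℂ (fun _ : Fin k => X) ℂ) (S : Finset (Fin k)),
      S ≠ Finset.univ ∧ ¬ Tendsto (fun i => partialDiag A S x₀ (x i - x₀)) l (𝓝 0) := by
  by_contra! hcon
  apply h
  obtain ⟨N, A, hA⟩ := hP
  simp only [hA]
  refine tendsto_finsetSum _ fun k _ => ?_
  have h1 : ∀ i, A k (fun _ => x i) = ∑ S, partialDiag (A k) S x₀ (x i - x₀) := by
    intro i
    refine Eq.trans (congrArg (A k) ?_) ((A k).map_add_univ (fun _ => x₀) (fun _ => x i - x₀))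
    ext j
    simp
  -- The term `S = univ` is the constant part; every other term has positive degree in `x i - x₀`.
  have h2 : A k (fun _ => x₀) =
      ∑ S : Finset (Fin k), if S = Finset.univ then A k (fun _ => x₀) else 0 := by
    simp
  simp only [h1]
  rw [h2]
  refine tendsto_finsetSum _ fun S _ => ?_
  split_ifs with hS
  · subst hS
    simpa [partialDiag] using tendsto_const_nhds
  · exact hcon k (A k) S hS

end Polynomials

/-! ### A second character in the fiber over `0`. -/

section Fiber

variable {X : Type*} [NormedAddCommGroup X] [NormedSpace ℂ X]

theorem continuous_apply_toWeakSpace_symm (l : StrongDual ℂ X) :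
    Continuous fun y : WeakSpace ℂ X => l ((toWeakSpace ℂ X).symm y) :=
  WeakBilin.eval_continuous (topDualPairing ℂ X).flip l

theorem exists_mem_fiber_zero_of_polynomial
    (hX : ∃ P : X → ℂ, IsContinuousPolynomial P ∧ ¬ IsWeaklyContinuousOnBall P)
    {𝒜 : Subalgebra ℂ (BallFun X)} (h𝒜 : Au X ≤ 𝒜) (h𝒜' : 𝒜 ≤ Hinf X) :
    ∃ φ ∈ fiber 𝒜 h𝒜 0, φ ≠ deltaZero 𝒜 ∧ φ ∈ gleasonPart (deltaZero 𝒜) := by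
  obtain ⟨P, hP, hPw⟩ := hX
  obtain ⟨x₀, hx₀, hnot⟩ : ∃ x₀ ∈ ball (0 : X) 1, ¬ Tendsto
      (fun y : WeakSpace ℂ X => P ((toWeakSpace ℂ X).symm y))
      (𝓝[toWeakSpace ℂ X '' ball (0 : X) 1] (toWeakSpace ℂ X x₀)) (𝓝 (P x₀)) := by
    by_contra! hcon
    refine hPw ?_
    rintro _ ⟨x, hx, rfl⟩
    exact hcon x hx
  obtain ⟨k, A, S, hS, hQ⟩ := exists_partialDiag_not_tendsto hP hnot
  have hx₀1 : ‖x₀‖ < 1 := mem_ball_zero_iff.1 hx₀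
  -- An ultrafilter keeps the failure of convergence while making every bounded function converge.
  rw [tendsto_iff_ultrafilter] at hQ
  push Not at hQ
  obtain ⟨U, hU, hUQ⟩ := hQ
  -- Differences of points of the unit ball have norm below `2`, so the factor `1/4` brings them
  -- into radius `1/2`.
  let T : WeakSpace ℂ X → X := fun y => (4 : ℂ)⁻¹ • ((toWeakSpace ℂ X).symm y - x₀)
  let G : Ultrafilter X := U.map T
  have hGr : ∀ᶠ x in (G : Filter X), ‖x‖ ≤ 1 / 2 := by
    rw [Ultrafilter.coe_map, eventually_map]
    filter_upwards [hU self_mem_nhdsWithin]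
    rintro _ ⟨x, hx, rfl⟩
    have hx1 : ‖x‖ < 1 := mem_ball_zero_iff.1 hx
    have h1 : T (toWeakSpace ℂ X x) = (4 : ℂ)⁻¹ • (x - x₀) := by simp [T]
    rw [h1, norm_smul, norm_inv]
    have : ‖(4 : ℂ)‖ = 4 := by simp
    rw [this]
    linarith [norm_sub_le x x₀]
  have hGball : ∀ᶠ x in (G : Filter X), x ∈ ball (0 : X) 1 := by
    filter_upwards [hGr] with x hx
    exact mem_ball_zero_iff.2 (hx.trans_lt (by norm_num))
  have hGl : ∀ l : StrongDual ℂ X, Tendsto (fun x => l x) G (𝓝 0) := by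
    intro l
    rw [Ultrafilter.coe_map, tendsto_map'_iff]
    have h1 : Tendsto (fun y : WeakSpace ℂ X => l ((toWeakSpace ℂ X).symm y)) U (𝓝 (l x₀)) :=
      (((continuous_apply_toWeakSpace_symm l).tendsto _).mono_left nhdsWithin_le_nhds).mono_left hU
    have h2 := (h1.sub_const (l x₀)).const_mul (4 : ℂ)⁻¹
    rw [sub_self, mul_zero] at h2
    refine h2.congr fun y => ?_
    simp [T]
  -- By homogeneity the rescaling only multiplies the values by a nonzero constant.
  have hGQ : ¬ Tendsto (partialDiag A S x₀) G (𝓝 0) := by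
    intro hcon
    apply hUQ
    rw [Ultrafilter.coe_map, tendsto_map'_iff] at hcon
    have h1 := hcon.const_mul ((4 : ℂ) ^ (Sᶜ).card)
    rw [mul_zero] at h1
    refine h1.congr fun y => ?_
    simp only [Function.comp_apply, T]
    rw [partialDiag_smul, ← mul_assoc, ← mul_pow]
    simp
  have hex : ∀ f : 𝒜, ∃ c : ℂ, Tendsto (zeroExt (f : BallFun X)) G (𝓝 c) := by
    intro f
    obtain ⟨c, -, hc⟩ := (isCompact_closedBall (0 : ℂ) ‖(f : BallFun X)‖).ultrafilter_le_nhds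
      (G.map (zeroExt (f : BallFun X))) (by
        rw [le_principal_iff, Ultrafilter.coe_map, mem_map]
        exact univ_mem' fun x => mem_closedBall_zero_iff.2 (norm_zeroExt_le _ x))
    exact ⟨c, hc⟩
  choose Φ hΦ using hex
  obtain ⟨φ, hφ, hφΦ⟩ := exists_mem_gleasonPart_of_tendsto h𝒜' one_half_lt_one hGr hΦ
  refine ⟨φ, ?_, ?_, hφ⟩
  · change projBidual 𝒜 h𝒜 φ = 0
    ext l
    change φ (dualIncl 𝒜 h𝒜 l) = 0
    rw [hφΦ]
    refine tendsto_nhds_unique (hΦ _) ((hGl l).congr' ?_)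
    filter_upwards [hGball] with x hx
    rw [zeroExt_of_mem _ hx]
    rfl
  · intro hcon
    apply hGQ
    let q : 𝒜 := ⟨partialDiagBall A S x₀ hx₀1.le, h𝒜 (partialDiagBall_mem_Au A S x₀ hx₀1.le)⟩
    have h0 : Φ q = 0 := by
      rw [← hφΦ, hcon, ← zeroExt_zero_eq_deltaZero]
      exact (zeroExt_partialDiagBall A S x₀ hx₀1.le (mem_ball_self one_pos)).trans
        (partialDiag_zero A S x₀ hS)
    have h1 := hΦ q
    rw [h0] at h1
    refine h1.congr' ?_
    filter_upwards [hGball] with x hx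
    exact zeroExt_partialDiagBall A S x₀ hx₀1.le hx

end Fiber

end GleasonParts

end

/-! ### Comparison of the bidual ball with the Gleason part. -/

open GleasonParts in
theorem mainTheorem10 {X : Type*} [NormedAddCommGroup X] [NormedSpace ℂ X] [CompleteSpace X]
    (hX : ∃ P : X → ℂ, IsContinuousPolynomial P ∧ ¬ IsWeaklyContinuousOnBall P)
    (𝒜 : Subalgebra ℂ (BallFun X)) (h𝒜 : Au X ≤ 𝒜) (h : 𝒜 = Au X ∨ 𝒜 = Hinf X) :
    Set.InjOn (delta 𝒜) (Metric.ball 0 1) ∧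
    delta 𝒜 '' Metric.ball 0 1 ⊂
      (fun (φ : WeakDual.characterSpace ℂ 𝒜) (f : 𝒜) => φ f) '' gleasonPart (deltaZero 𝒜) ∧
    ∃ φ ∈ fiber 𝒜 h𝒜 0, φ ≠ deltaZero 𝒜 ∧ φ ∈ gleasonPart (deltaZero 𝒜) := by
  have h𝒜' : 𝒜 ≤ Hinf X := by
    rcases h with rfl | rfl
    · exact Au_le_Hinf X
    · exact le_rfl
  have hball : ∀ z ∈ Metric.ball (0 : StrongDual ℂ (StrongDual ℂ X)) 1, ‖z‖ < 1 :=
    fun z hz => (dist_zero_right z).symm.trans_lt hz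
  obtain ⟨φ, hfib, hne, hφ⟩ := exists_mem_fiber_zero_of_polynomial hX h𝒜 h𝒜'
  refine ⟨fun z hz w hw hzw => ?_, ⟨?_, fun hsub => ?_⟩, φ, hfib, hne, hφ⟩
  · ext l
    rw [← delta_dualIncl h𝒜 (hball z hz), hzw,
      delta_dualIncl h𝒜 (hball w hw)]
  · rintro _ ⟨z, hz, rfl⟩
    obtain ⟨ψ, hψ, hψz⟩ := exists_mem_gleasonPart_eq_delta h𝒜' (hball z hz)
    exact ⟨ψ, hψ, funext hψz⟩
  -- If `φ` were some `δ_z`, its vanishing on `X*` would give `z = 0`, hence `φ = δ_0`.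
  · obtain ⟨z, hz, hzφ⟩ := hsub ⟨φ, hφ, rfl⟩
    have hz0 : z = 0 := by
      ext l
      rw [← delta_dualIncl h𝒜 (hball z hz), hzφ]
      exact DFunLike.congr_fun (show projBidual 𝒜 h𝒜 φ = 0 from hfib) l
    apply hne
    ext f
    have h1 : delta 𝒜 z f = φ f := congrFun hzφ f
    rw [← h1, hz0]
    exact (canonicalExt_zero _).trans (zeroExt_zero_eq_deltaZero f)
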